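/- Let $n>1$ and let $\mathbb M^n=\mathbb R^n$ be $n$-dimensional Minkowski space with the form $\langle x,y\rangle=-x_0y_0+x_1y_1+\dots+x_{n-1}y_{n-1}$. Let $\mathcal L_0$ be the connected component of the identity in the full Lorentz group $O(n-1,1)$, acting linearly on $\mathbb M^n$, and let $\mathcal H=\{x\in\mathbb M^n:\langle x,x\rangle=-1,\ x_0>0\}$ be the hyperboloid of unit future-timelike vectors, with its Borel $\sigma$-algebra. Let $\Omega$ be the set of locally finite subsets of $\mathbb M^n$ ("sprinklings"), with the $\sigma$-algebra $\Sigma$ generated by the maps $\omega\mapsto|\omega\cap B|$, $B\subset\mathbb M^n$ bounded Borel, and with the action $\Lambda\omega=\{\Lambda x:x\in\omega\}$ of $\mathcal L_0$. Let $\mu$ be the law on $(\Omega,\Sigma)$ of the Poisson process of density $\rho>0$ with respect to Lebesgue measure, that is, the probability measure under which $|\omega\cap B|$ is Poisson distributed with mean $\rho\operatorname{vol}(B)$ for every bounded Borel set $B$, and under which the numbers of points in finitely many pairwise disjoint bounded Borel sets are independent. Let $S\in\Sigma$ with $\mu(S)>0$. Then there is no measurable map $D:S\to\mathcal H$ that is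 $\mathcal L_0$-equivariant, i.e. such that $$D(\Lambda\omega)=\Lambda D(\omega)\qquad\text{for all }\Lambda\in\mathcal L_0\text{ and all }\omega\in S\text{ with }\Lambda\omega\in S .$$ In particular this holds when $S$ is $\mathcal L_0$-invariant. -/

import Mathlib

open MeasureTheory ProbabilityTheory
open scoped NNReal ENNReal Matrix

noncomputable section

/-- Minkowski space of dimension `d + 1`, in inertial coordinates centred at the origin `O`:
coordinate `0` is time, the other `d` coordinates are space. -/
abbrev Minkowski (d : ℕ) : Type := Fin (d + 1) → ℝ

/-- The matrix `diag (-1, 1, …, 1)` of the Minkowski inner product. -/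
def minkowskiMatrix (d : ℕ) : Matrix (Fin (d + 1)) (Fin (d + 1)) ℝ :=
  Matrix.diagonal fun i => if i = 0 then -1 else 1

/-- The Minkowski inner product `-x₀ y₀ + x₁ y₁ + ⋯ + x_d y_d`. -/
def minkowskiInner {d : ℕ} (x y : Minkowski d) : ℝ :=
  x ⬝ᵥ (minkowskiMatrix d *ᵥ y)

/-- The full Lorentz group `O(d, 1)`, with the topology induced from `GL (d + 1, ℝ)`. -/
def fullLorentzGroup (d : ℕ) : Subgroup (GL (Fin (d + 1)) ℝ) where
  carrier := {A | ∀ x y : Minkowski d,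
    minkowskiInner ((A : Matrix (Fin (d + 1)) (Fin (d + 1)) ℝ) *ᵥ x)
      ((A : Matrix (Fin (d + 1)) (Fin (d + 1)) ℝ) *ᵥ y) = minkowskiInner x y}
  one_mem' := by intro x y; simp
  mul_mem' := by
    intro A B hA hB x y
    have h := hA ((B : Matrix (Fin (d + 1)) (Fin (d + 1)) ℝ) *ᵥ x)
      ((B : Matrix (Fin (d + 1)) (Fin (d + 1)) ℝ) *ᵥ y)
    rw [hB x y] at h
    simpa [Matrix.mulVec_mulVec] using h
  inv_mem' := by
    intro A hA x y
    have h := hA (((A⁻¹ : GL (Fin (d + 1)) ℝ) : Matrix (Fin (d + 1)) (Fin (d + 1)) ℝ) *ᵥ x)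
      (((A⁻¹ : GL (Fin (d + 1)) ℝ) : Matrix (Fin (d + 1)) (Fin (d + 1)) ℝ) *ᵥ y)
    rw [Matrix.mulVec_mulVec, Matrix.mulVec_mulVec, Units.mul_inv, Matrix.one_mulVec,
      Matrix.one_mulVec] at h
    exact h.symm

/-- The Lorentz group `L₀`: the connected component of the identity in `O(d, 1)`. -/
def lorentzGroup (d : ℕ) : Subgroup (GL (Fin (d + 1)) ℝ) :=
  (Subgroup.connectedComponentOfOne (fullLorentzGroup d)).map (fullLorentzGroup d).subtype

/-- The linear action of a Lorentz transformation on Minkowski space, fixing the origin. -/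
def lorentzAct {d : ℕ} (L : lorentzGroup d) (x : Minkowski d) : Minkowski d :=
  ((L : GL (Fin (d + 1)) ℝ) : Matrix (Fin (d + 1)) (Fin (d + 1)) ℝ) *ᵥ x

/-- The hyperboloid `H` of unit future-timelike vectors, a measurable space with the Borel
σ-algebra it inherits as a subspace of Minkowski space. -/
abbrev Hyperboloid (d : ℕ) : Type :=
  {x : Minkowski d // minkowskiInner x x = -1 ∧ 0 < x 0}

/-- A possible sprinkling, that is, a point of `Ω`: a locally finite subset of Minkowski space
(equivalently, a subset without accumulation points). -/
@[ext]
structure Sprinkling (d : ℕ) where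
  points : Set (Minkowski d)
  locallyFinite : ∀ K : Set (Minkowski d), IsCompact K → (points ∩ K).Finite

/-- The number of points of a sprinkling in a region. It is used for bounded regions only, where
it is always finite. -/
def Sprinkling.count {d : ℕ} (B : Set (Minkowski d)) (ω : Sprinkling d) : ℕ :=
  (ω.points ∩ B).ncard

/-- The σ-algebra `Σ` on `Ω`: the smallest one for which the number of points in each bounded
Borel set is a measurable function. -/
instance Sprinkling.instMeasurableSpace (d : ℕ) : MeasurableSpace (Sprinkling d) :=
  MeasurableSpace.generateFrom
    {E | ∃ B : Set (Minkowski d), MeasurableSet B ∧ Bornology.IsBounded B ∧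
      ∃ k : ℕ, E = {ω | ω.count B = k}}

/-- The action of the Lorentz group on sprinklings, pointwise. -/
def Sprinkling.act {d : ℕ} (L : lorentzGroup d) (ω : Sprinkling d) : Sprinkling d where
  points := lorentzAct L '' ω.points
  locallyFinite := by
    intro K hK
    have hK' : IsCompact (lorentzAct L⁻¹ '' K) := by
      refine hK.image ?_
      unfold lorentzAct
      fun_prop
    refine ((ω.locallyFinite _ hK').image (lorentzAct L)).subset ?_
    rintro _ ⟨⟨x, hx, rfl⟩, hxK⟩
    refine ⟨x, ⟨hx, lorentzAct L x, hxK, ?_⟩, rfl⟩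
    simp only [lorentzAct, Matrix.mulVec_mulVec, Subgroup.coe_inv]
    rw [Units.inv_mul, Matrix.one_mulVec]

/-- `μ` is the law on `Ω` of the Poisson process of density `ρ`: the number of points in a bounded
Borel set of volume `V` is Poisson distributed with mean `ρ V`, and the numbers of points in
finitely many pairwise disjoint bounded Borel sets are independent. -/
structure IsPoissonProcess {d : ℕ} (ρ : ℝ) (μ : Measure (Sprinkling d)) : Prop where
  isProbabilityMeasure : IsProbabilityMeasure μ
  poisson : ∀ B : Set (Minkowski d), MeasurableSet B → Bornology.IsBounded B → ∀ k : ℕ,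
    μ {ω | ω.count B = k} = ENNReal.ofReal
      ((ρ * (volume B).toReal) ^ k * Real.exp (-(ρ * (volume B).toReal)) / (k.factorial : ℝ))
  independent : ∀ (m : ℕ) (B : Fin m → Set (Minkowski d)), (∀ i, MeasurableSet (B i)) →
    (∀ i, Bornology.IsBounded (B i)) → Pairwise (fun i j => Disjoint (B i) (B j)) →
    iIndepFun (fun i => Sprinkling.count (B i)) μ

end


/-!
A Poisson process is determined by the law of its counts, which depends on space-time only through
the volume, and Lorentz transformations have determinant `±1`; so `μ` is `L₀`-invariant. Let `Λ` be
a boost. By Poincaré recurrence, almost every `ω ∈ S` has iterates `Λⁿ ω` that return to `S` with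
`D (Λⁿ ω)` as close to `D ω` as desired, so by equivariance `D ω` is a cluster point of its own
orbit `Λⁿ (D ω)`. But `Λ` multiplies the light-cone coordinate `x₀ + xⱼ`, positive on the
hyperboloid, by a constant greater than `1`, so no orbit of `Λ` in the hyperboloid has a cluster
point.
-/

open Filter Function Set Topology

section Recurrence

variable {X Y : Type*} [MeasurableSpace X] {μ : Measure X} {f : X → X} {S : Set X}
  [TopologicalSpace Y] [SecondCountableTopology Y] [MeasurableSpace Y] [OpensMeasurableSpace Y]
  {D : S → Y}

theorem ae_frequently_mem_image_preimage_of_conservative (hf : Conservative f μ)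
    (hS : NullMeasurableSet S μ) (hD : Measurable D) :
    ∀ᵐ x ∂μ, ∀ hx : x ∈ S, ∀ V ∈ 𝓝 (D ⟨x, hx⟩), ∃ᶠ n in atTop, f^[n] x ∈ (↑) '' (D ⁻¹' V) := by
  have hnull (V : Set Y) (hV : IsOpen V) : NullMeasurableSet ((↑) '' (D ⁻¹' V) : Set X) μ := by
    obtain ⟨A, hA, hAV⟩ := hD hV.measurableSet
    rw [← hAV, Subtype.image_preimage_coe]
    exact hS.inter hA.nullMeasurableSet
  have hbasis : ∀ V ∈ TopologicalSpace.countableBasis Y, ∀ᵐ x ∂μ,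
      x ∈ ((↑) '' (D ⁻¹' V) : Set X) → ∃ᶠ n in atTop, f^[n] x ∈ ((↑) '' (D ⁻¹' V) : Set X) :=
    fun V hV ↦ hf.ae_mem_imp_frequently_image_mem
      (hnull V (TopologicalSpace.isOpen_of_mem_countableBasis hV))
  filter_upwards [(ae_ball_iff (TopologicalSpace.countable_countableBasis Y)).2 hbasis]
    with x hreturn hx V hV
  obtain ⟨W, hW, hxW, hWV⟩ :=
    (TopologicalSpace.isBasis_countableBasis Y).mem_nhds_iff.1 hV
  exact (hreturn W hW ⟨⟨x, hx⟩, hxW, rfl⟩).mono fun n hn ↦ image_mono (preimage_mono hWV) hn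

theorem ae_mapClusterPt_iterate_of_conservative (hf : Conservative f μ)
    (hS : NullMeasurableSet S μ) (hD : Measurable D) {g : Y → Y}
    (hDf : ∀ (n : ℕ) (x : S) (hx : f^[n] x ∈ S), D ⟨f^[n] x, hx⟩ = g^[n] (D x)) :
    ∀ᵐ x ∂μ, ∀ hx : x ∈ S, MapClusterPt (D ⟨x, hx⟩) atTop fun n ↦ g^[n] (D ⟨x, hx⟩) := by
  filter_upwards [ae_frequently_mem_image_preimage_of_conservative hf hS hD] with x hreturn hx
  refine mapClusterPt_iff_frequently.2 fun V hV ↦ (hreturn hx V hV).mono ?_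
  rintro n ⟨⟨_, hn⟩, hyV, rfl⟩
  rwa [mem_preimage, hDf n ⟨x, hx⟩] at hyV

end Recurrence

theorem iIndepFun_map_iff {Ω Ω' ι : Type*} {E : ι → Type*} [MeasurableSpace Ω] [MeasurableSpace Ω']
    [∀ i, MeasurableSpace (E i)] {μ : Measure Ω} {T : Ω → Ω'} (hT : Measurable T)
    {X : ∀ i, Ω' → E i} (hX : ∀ i, Measurable (X i)) :
    iIndepFun X (μ.map T) ↔ iIndepFun (fun i ↦ X i ∘ T) μ := by
  simp only [iIndepFun_iff_measure_inter_preimage_eq_mul]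
  refine forall₃_congr fun s A hA ↦ ?_
  have hXA : ∀ i ∈ s, MeasurableSet (X i ⁻¹' A i) := fun i hi ↦ hX i (hA i hi)
  rw [Measure.map_apply hT (s.measurableSet_biInter hXA), preimage_iInter₂,
    Finset.prod_congr rfl fun i hi ↦ Measure.map_apply hT (hXA i hi)]
  rfl

theorem measure_eq_of_forall_finset_map_restrict_eq {Ω T : Type*} {E : T → Type*}
    [mΩ : MeasurableSpace Ω] [∀ t, MeasurableSpace (E t)] {μ ν : Measure Ω} [IsFiniteMeasure μ]
    {X : ∀ t, Ω → E t} (hX : ∀ t, Measurable (X t))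
    (hgen : mΩ ≤ MeasurableSpace.comap (fun ω t ↦ X t ω) MeasurableSpace.pi)
    (h : ∀ I : Finset T, μ.map (fun ω ↦ I.restrict (X · ω)) = ν.map fun ω ↦ I.restrict (X · ω)) :
    μ = ν := by
  have hXm : Measurable fun ω t ↦ X t ω := measurable_pi_lambda _ hX
  have hlaw : μ.map (fun ω t ↦ X t ω) = ν.map fun ω t ↦ X t ω := by
    have hν := isProjectiveLimit_map (P := ν) hXm.aemeasurable
    simp_rw [← h] at hν
    exact (isProjectiveLimit_map hXm.aemeasurable).unique hν
  ext A hA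
  obtain ⟨B, hB, rfl⟩ := hgen A hA
  rw [← Measure.map_apply hXm hB, hlaw, Measure.map_apply hXm hB]

theorem exists_pairwise_disjoint_refinement {α ι : Type*} [MeasurableSpace α] [Countable ι]
    {B : ι → Set α} (hB : ∀ i, MeasurableSet (B i)) :
    ∃ A : Set ι → Set α, (∀ t, MeasurableSet (A t)) ∧ (∀ t, A t ⊆ ⋃ i, B i) ∧
      Pairwise (Disjoint on A) ∧ ∀ i, B i = ⋃ t ∈ {t : Set ι | i ∈ t}, A t := by
  -- The atoms are cut by `⋃ i, B i` so that they stay bounded when all `B i` are.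
  let membership : α → Set ι := fun x ↦ {i | x ∈ B i}
  have hmem : Measurable membership := measurable_set_iff.2 fun i ↦ (hB i).mem
  refine ⟨fun t ↦ (⋃ i, B i) ∩ membership ⁻¹' {t},
    fun t ↦ (MeasurableSet.iUnion hB).inter (hmem (measurableSet_singleton t)),
    fun t ↦ inter_subset_left, fun s t hst ↦ ?_, fun i ↦ ?_⟩
  · exact ((disjoint_singleton.2 hst).preimage membership).mono inter_subset_right
      inter_subset_right
  · rw [← inter_iUnion₂, biUnion_preimage_singleton]
    exact (inter_eq_right.2 (subset_iUnion B i)).symm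

namespace Sprinkling

variable {d : ℕ}

theorem measurable_count {B : Set (Minkowski d)} (hB : MeasurableSet B)
    (hb : Bornology.IsBounded B) : Measurable (count B) :=
  measurable_to_countable' fun k ↦
    MeasurableSpace.measurableSet_generateFrom ⟨B, hB, hb, k, rfl⟩

theorem finite_inter (ω : Sprinkling d) {B : Set (Minkowski d)} (hb : Bornology.IsBounded B) :
    (ω.points ∩ B).Finite :=
  (ω.locallyFinite _ hb.isCompact_closure).subset (inter_subset_inter_right _ subset_closure)

theorem count_biUnion (ω : Sprinkling d) {κ : Type*} {t : Set κ} (ht : t.Finite)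
    {A : κ → Set (Minkowski d)} (hb : ∀ i ∈ t, Bornology.IsBounded (A i))
    (hA : t.PairwiseDisjoint A) : ω.count (⋃ i ∈ t, A i) = ∑ᶠ i ∈ t, ω.count (A i) := by
  rw [count, inter_iUnion₂, ht.ncard_biUnion (fun i hi ↦ ω.finite_inter (hb i hi))
    (hA.mono fun i ↦ inter_subset_right)]
  rfl

end Sprinkling

namespace IsPoissonProcess

variable {d : ℕ} {ρ : ℝ} {μ ν : Measure (Sprinkling d)}

theorem map_count_eq (hμ : IsPoissonProcess ρ μ) (hν : IsPoissonProcess ρ ν)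
    {B : Set (Minkowski d)} (hB : MeasurableSet B) (hb : Bornology.IsBounded B) :
    μ.map (Sprinkling.count B) = ν.map (Sprinkling.count B) := by
  refine Measure.ext_of_singleton fun k ↦ ?_
  have hm := Sprinkling.measurable_count hB hb
  rw [Measure.map_apply hm (measurableSet_singleton k),
    Measure.map_apply hm (measurableSet_singleton k)]
  exact (hμ.poisson B hB hb k).trans (hν.poisson B hB hb k).symm

theorem iIndepFun_count (hμ : IsPoissonProcess ρ μ) {κ : Type*} [Finite κ]
    {A : κ → Set (Minkowski d)} (hA : ∀ i, MeasurableSet (A i))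
    (hb : ∀ i, Bornology.IsBounded (A i)) (hd : Pairwise (Disjoint on A)) :
    iIndepFun (fun i ↦ Sprinkling.count (A i)) μ := by
  let e := Finite.equivFin κ
  have h := hμ.independent _ (A ∘ e.symm) (fun i ↦ hA _) (fun i ↦ hb _)
    (hd.comp_of_injective e.symm.injective)
  simpa [Function.comp_def] using h.precomp e.injective

theorem map_count_pi_eq_of_disjoint (hμ : IsPoissonProcess ρ μ) (hν : IsPoissonProcess ρ ν)
    {κ : Type*} [Finite κ] {A : κ → Set (Minkowski d)} (hA : ∀ i, MeasurableSet (A i))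
    (hb : ∀ i, Bornology.IsBounded (A i)) (hd : Pairwise (Disjoint on A)) :
    μ.map (fun ω i ↦ ω.count (A i)) = ν.map fun ω i ↦ ω.count (A i) := by
  have hm := fun i ↦ Sprinkling.measurable_count (hA i) (hb i)
  have hlaw := fun i ↦ hμ.map_count_eq hν (hA i) (hb i)
  rw [(hμ.iIndepFun_count hA hb hd).map_fun_eq_infinitePi_map hm,
    (hν.iIndepFun_count hA hb hd).map_fun_eq_infinitePi_map hm]
  simp_rw [hlaw]

theorem map_count_pi_eq (hμ : IsPoissonProcess ρ μ) (hν : IsPoissonProcess ρ ν)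
    {ι : Type*} [Finite ι] {B : ι → Set (Minkowski d)} (hB : ∀ i, MeasurableSet (B i))
    (hb : ∀ i, Bornology.IsBounded (B i)) :
    μ.map (fun ω i ↦ ω.count (B i)) = ν.map fun ω i ↦ ω.count (B i) := by
  obtain ⟨A, hA, hAB, hd, hBA⟩ := exists_pairwise_disjoint_refinement hB
  have hAb : ∀ t, Bornology.IsBounded (A t) := fun t ↦
    (Bornology.isBounded_iUnion.2 hb).subset (hAB t)
  let sumOver : (Set ι → ℕ) → ι → ℕ := fun c i ↦ ∑ᶠ t ∈ {t : Set ι | i ∈ t}, c t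
  have hcount : (fun (ω : Sprinkling d) i ↦ ω.count (B i)) =
      sumOver ∘ fun ω t ↦ ω.count (A t) := by
    funext ω i
    rw [hBA i]
    exact ω.count_biUnion (toFinite _) (fun t _ ↦ hAb t) (hd.set_pairwise _)
  have hm : Measurable fun (ω : Sprinkling d) t ↦ ω.count (A t) :=
    measurable_pi_lambda _ fun t ↦ Sprinkling.measurable_count (hA t) (hAb t)
  have hsum : Measurable sumOver := measurable_of_countable _
  rw [hcount, ← Measure.map_map hsum hm, ← Measure.map_map hsum hm,
    hμ.map_count_pi_eq_of_disjoint hν hA hAb hd]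

theorem unique (hμ : IsPoissonProcess ρ μ) (hν : IsPoissonProcess ρ ν) : μ = ν := by
  have := hμ.isProbabilityMeasure
  let 𝓑 := {B : Set (Minkowski d) // MeasurableSet B ∧ Bornology.IsBounded B}
  refine measure_eq_of_forall_finset_map_restrict_eq
    (X := fun (B : 𝓑) ω ↦ ω.count B.1) (fun B ↦ Sprinkling.measurable_count B.2.1 B.2.2)
    (MeasurableSpace.generateFrom_le ?_)
    fun I ↦ hμ.map_count_pi_eq hν (fun B : I ↦ B.1.2.1) fun B ↦ B.1.2.2
  rintro _ ⟨B, hB, hb, k, rfl⟩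
  have heval : Measurable fun c : 𝓑 → ℕ ↦ c ⟨B, hB, hb⟩ := measurable_pi_apply _
  exact ⟨_, heval (measurableSet_singleton k), rfl⟩

end IsPoissonProcess

section LorentzGroup

variable {d : ℕ}

theorem mem_fullLorentzGroup_iff {A : GL (Fin (d + 1)) ℝ} :
    A ∈ fullLorentzGroup d ↔ A.1ᵀ * minkowskiMatrix d * A.1 = minkowskiMatrix d := by
  have hinner (x y : Minkowski d) : minkowskiInner (A.1 *ᵥ x) (A.1 *ᵥ y) =
      x ⬝ᵥ ((A.1ᵀ * minkowskiMatrix d * A.1) *ᵥ y) := by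
    rw [minkowskiInner, ← Matrix.mulVec_mulVec, ← Matrix.mulVec_mulVec, Matrix.dotProduct_mulVec x,
      Matrix.vecMul_transpose]
  change (∀ x y : Minkowski d, minkowskiInner (A.1 *ᵥ x) (A.1 *ᵥ y) = minkowskiInner x y) ↔ _
  simp only [hinner]
  simp only [minkowskiInner]
  refine ⟨fun h ↦ Matrix.ext_of_mulVec_single fun j ↦ dotProduct_eq _ _ fun x ↦ ?_,
    fun h x y ↦ by rw [h]⟩
  simpa only [dotProduct_comm x] using h x (Pi.single j 1)

theorem abs_det_of_mem_fullLorentzGroup {A : GL (Fin (d + 1)) ℝ} (hA : A ∈ fullLorentzGroup d) :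
    |A.1.det| = 1 := by
  have hη : (minkowskiMatrix d).det ≠ 0 := by
    rw [minkowskiMatrix, Matrix.det_diagonal, Finset.prod_ne_zero_iff]
    intro i _
    split_ifs <;> norm_num
  have hdet := congrArg Matrix.det (mem_fullLorentzGroup_iff.1 hA)
  rw [Matrix.det_mul, Matrix.det_mul, Matrix.det_transpose] at hdet
  rw [← abs_one, ← sq_eq_sq_iff_abs_eq_abs, one_pow]
  exact mul_left_cancel₀ hη (by linear_combination hdet)

theorem lorentzGroup_le_fullLorentzGroup : lorentzGroup d ≤ fullLorentzGroup d :=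
  Subgroup.map_subtype_le _

theorem lorentzAct_mul (L M : lorentzGroup d) (x : Minkowski d) :
    lorentzAct (L * M) x = lorentzAct L (lorentzAct M x) := by
  simp [lorentzAct, Matrix.mulVec_mulVec]

theorem lorentzAct_one (x : Minkowski d) : lorentzAct 1 x = x := by
  simp [lorentzAct]

theorem lorentzAct_iterate (L : lorentzGroup d) (n : ℕ) (x : Minkowski d) :
    (lorentzAct L)^[n] x = lorentzAct (L ^ n) x := by
  induction n with
  | zero => simp [lorentzAct_one]
  | succ n ih => rw [iterate_succ_apply', ih, pow_succ', lorentzAct_mul]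

theorem lorentzAct_inv_lorentzAct (L : lorentzGroup d) (x : Minkowski d) :
    lorentzAct L⁻¹ (lorentzAct L x) = x := by
  rw [← lorentzAct_mul, inv_mul_cancel, lorentzAct_one]

theorem lorentzAct_injective (L : lorentzGroup d) : Injective (lorentzAct L) :=
  LeftInverse.injective (lorentzAct_inv_lorentzAct L)

theorem continuous_lorentzAct (L : lorentzGroup d) : Continuous (lorentzAct L) := by
  unfold lorentzAct
  fun_prop

theorem isBounded_preimage_lorentzAct (L : lorentzGroup d) {B : Set (Minkowski d)}
    (hb : Bornology.IsBounded B) : Bornology.IsBounded (lorentzAct L ⁻¹' B) :=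
  (hb.isCompact_closure.image (continuous_lorentzAct L⁻¹)).isBounded.subset fun x hx ↦
    ⟨lorentzAct L x, subset_closure hx, lorentzAct_inv_lorentzAct L x⟩

theorem measurePreserving_lorentzAct (L : lorentzGroup d) : MeasurePreserving (lorentzAct L) := by
  refine ⟨(continuous_lorentzAct L).measurable, ?_⟩
  have habs := abs_det_of_mem_fullLorentzGroup (lorentzGroup_le_fullLorentzGroup L.2)
  have hdet : L.1.1.det ≠ 0 := abs_pos.1 (habs ▸ one_pos)
  have hmap := Real.map_matrix_volume_pi_eq_smul_volume_pi hdet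
  rwa [abs_inv, habs, inv_one, ENNReal.ofReal_one, one_smul] at hmap

end LorentzGroup

namespace Sprinkling

variable {d : ℕ}

instance instMulAction : MulAction (lorentzGroup d) (Sprinkling d) where
  smul := act
  one_smul _ := Sprinkling.ext <| (image_congr fun x _ ↦ lorentzAct_one x).trans (image_id' _)
  mul_smul L M _ := Sprinkling.ext <|
    (image_congr fun x _ ↦ lorentzAct_mul L M x).trans (image_image _ _ _).symm

theorem count_smul (L : lorentzGroup d) (B : Set (Minkowski d)) (ω : Sprinkling d) :
    (L • ω).count B = ω.count (lorentzAct L ⁻¹' B) := by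
  change (lorentzAct L '' ω.points ∩ B).ncard = _
  rw [count, ← image_inter_preimage, ncard_image_of_injective _ (lorentzAct_injective L)]

instance instMeasurableConstSMul : MeasurableConstSMul (lorentzGroup d) (Sprinkling d) where
  measurable_const_smul L := by
    refine measurable_generateFrom ?_
    rintro _ ⟨B, hB, hb, k, rfl⟩
    simp only [preimage_ofPred_eq, count_smul]
    exact measurable_count ((continuous_lorentzAct L).measurable hB)
      (isBounded_preimage_lorentzAct L hb) (measurableSet_singleton k)

end Sprinkling

namespace IsPoissonProcess

variable {d : ℕ} {ρ : ℝ} {μ : Measure (Sprinkling d)}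

theorem map_smul (hμ : IsPoissonProcess ρ μ) (L : lorentzGroup d) :
    IsPoissonProcess ρ (μ.map (L • ·)) := by
  have := hμ.isProbabilityMeasure
  have hL : Measurable (L • · : Sprinkling d → Sprinkling d) := measurable_const_smul L
  have hpre {B : Set (Minkowski d)} (hB : MeasurableSet B) : MeasurableSet (lorentzAct L ⁻¹' B) :=
    (continuous_lorentzAct L).measurable hB
  refine ⟨Measure.isProbabilityMeasure_map hL.aemeasurable, fun B hB hb k ↦ ?_,
    fun m B hB hb hd ↦ ?_⟩
  · have hk : MeasurableSet {ω : Sprinkling d | ω.count B = k} :=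
      Sprinkling.measurable_count hB hb (measurableSet_singleton k)
    rw [Measure.map_apply hL hk,
      ← (measurePreserving_lorentzAct L).measure_preimage hB.nullMeasurableSet,
      ← hμ.poisson _ (hpre hB) (isBounded_preimage_lorentzAct L hb)]
    simp only [preimage_ofPred_eq, Sprinkling.count_smul]
  · rw [iIndepFun_map_iff hL fun i ↦ Sprinkling.measurable_count (hB i) (hb i)]
    simp only [Function.comp_def, Sprinkling.count_smul]
    exact hμ.independent m _ (fun i ↦ hpre (hB i))
      (fun i ↦ isBounded_preimage_lorentzAct L (hb i)) fun i j hij ↦ (hd hij).preimage _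

theorem smulInvariantMeasure (hμ : IsPoissonProcess ρ μ) :
    SMulInvariantMeasure (lorentzGroup d) (Sprinkling d) μ where
  measure_preimage_smul L E hE := by
    rw [← Measure.map_apply (measurable_const_smul L) hE, (hμ.map_smul L).unique hμ]

end IsPoissonProcess

section Boost

open Matrix

variable {d : ℕ}

/-- The matrix of the boost of rapidity `t` along the `j`-th spatial axis: it acts by
`!![cosh t, sinh t; sinh t, cosh t]` on the coordinates `0` and `j.succ` and fixes the others. -/
noncomputable def boostMatrix (j : Fin d) (t : ℝ) : Matrix (Fin (d + 1)) (Fin (d + 1)) ℝ :=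
  1 + (Real.cosh t - 1) • (single 0 0 1 + single j.succ j.succ 1) +
    Real.sinh t • (single 0 j.succ 1 + single j.succ 0 1)

theorem boostMatrix_zero (j : Fin d) : boostMatrix j 0 = 1 := by
  simp [boostMatrix]

theorem boostMatrix_mul_boostMatrix (j : Fin d) (s t : ℝ) :
    boostMatrix j s * boostMatrix j t = boostMatrix j (s + t) := by
  have h : (0 : Fin (d + 1)) ≠ j.succ := (Fin.succ_ne_zero j).symm
  simp only [boostMatrix, mul_add, add_mul, smul_mul_assoc, mul_smul_comm, one_mul, mul_one,
    smul_add, single_mul_single_same, single_mul_single_of_ne _ _ _ _ h,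
    single_mul_single_of_ne _ _ _ _ h.symm, Real.cosh_add, Real.sinh_add]
  module

theorem transpose_boostMatrix (j : Fin d) (t : ℝ) : (boostMatrix j t)ᵀ = boostMatrix j t := by
  simp only [boostMatrix, transpose_add, transpose_smul, transpose_one, transpose_single]
  rw [add_comm (single j.succ 0 (1 : ℝ))]

theorem boostMatrix_mul_minkowskiMatrix (j : Fin d) (t : ℝ) :
    boostMatrix j t * minkowskiMatrix d = minkowskiMatrix d * boostMatrix j (-t) := by
  ext i k
  simp only [boostMatrix, minkowskiMatrix, mul_diagonal, diagonal_mul, Matrix.add_apply,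
    Matrix.smul_apply, smul_eq_mul, one_apply, single_apply, Real.cosh_neg, Real.sinh_neg]
  grind

theorem continuous_boostMatrix (j : Fin d) : Continuous (boostMatrix j) := by
  unfold boostMatrix
  fun_prop

/-- The boost of rapidity `t` along the `j`-th spatial axis, as an invertible matrix. -/
noncomputable def boostGL (j : Fin d) (t : ℝ) : GL (Fin (d + 1)) ℝ where
  val := boostMatrix j t
  inv := boostMatrix j (-t)
  val_inv := by rw [boostMatrix_mul_boostMatrix, add_neg_cancel, boostMatrix_zero]
  inv_val := by rw [boostMatrix_mul_boostMatrix, neg_add_cancel, boostMatrix_zero]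

theorem boostGL_mem_fullLorentzGroup (j : Fin d) (t : ℝ) : boostGL j t ∈ fullLorentzGroup d := by
  rw [mem_fullLorentzGroup_iff]
  change (boostMatrix j t)ᵀ * _ * boostMatrix j t = _
  rw [transpose_boostMatrix, boostMatrix_mul_minkowskiMatrix, Matrix.mul_assoc,
    boostMatrix_mul_boostMatrix, neg_add_cancel, boostMatrix_zero, Matrix.mul_one]

theorem continuous_boostGL (j : Fin d) : Continuous (boostGL j) :=
  Units.continuous_iff.2
    ⟨continuous_boostMatrix j, (continuous_boostMatrix j).comp continuous_neg⟩

theorem boostGL_mem_lorentzGroup (j : Fin d) (t : ℝ) : boostGL j t ∈ lorentzGroup d := by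
  let γ : ℝ → fullLorentzGroup d := fun s ↦ ⟨boostGL j s, boostGL_mem_fullLorentzGroup j s⟩
  have hγ : Continuous γ := (continuous_boostGL j).subtype_mk _
  have hγ0 : γ 0 = 1 := Subtype.ext (Units.ext (boostMatrix_zero j))
  exact ⟨γ t, (isPreconnected_range hγ).subset_connectedComponent ⟨0, hγ0⟩ ⟨t, rfl⟩, rfl⟩

/-- The boost of rapidity `t` along the `j`-th spatial axis, as an element of `L₀`. -/
noncomputable def boost (j : Fin d) (t : ℝ) : lorentzGroup d :=
  ⟨boostGL j t, boostGL_mem_lorentzGroup j t⟩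

/-- The light-cone coordinate along the `j`-th spatial axis, an eigenfunction of the boosts along
that axis. -/
def lightConeCoord (j : Fin d) (x : Minkowski d) : ℝ :=
  x 0 + x j.succ

theorem continuous_lightConeCoord (j : Fin d) : Continuous (lightConeCoord j) := by
  unfold lightConeCoord
  fun_prop

theorem lightConeCoord_boost (j : Fin d) (t : ℝ) (x : Minkowski d) :
    lightConeCoord j (lorentzAct (boost j t) x) = Real.exp t * lightConeCoord j x := by
  change lightConeCoord j (boostMatrix j t *ᵥ x) = _
  have hj : j.succ ≠ 0 := Fin.succ_ne_zero j
  have htime : (boostMatrix j t *ᵥ x) 0 = Real.cosh t * x 0 + Real.sinh t * x j.succ := by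
    simp only [boostMatrix, smul_add, smul_single, smul_eq_mul, mul_one, add_mulVec, one_mulVec,
      single_mulVec, Pi.add_apply, update_self, update_of_ne hj.symm, Pi.zero_apply]
    ring
  have hspace : (boostMatrix j t *ᵥ x) j.succ = Real.sinh t * x 0 + Real.cosh t * x j.succ := by
    simp only [boostMatrix, smul_add, smul_single, smul_eq_mul, mul_one, add_mulVec, one_mulVec,
      single_mulVec, Pi.add_apply, update_self, update_of_ne hj, Pi.zero_apply]
    ring
  rw [lightConeCoord, lightConeCoord, htime, hspace, ← Real.cosh_add_sinh]
  ring

theorem lightConeCoord_iterate_boost (j : Fin d) (t : ℝ) (n : ℕ) (x : Minkowski d) :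
    lightConeCoord j ((lorentzAct (boost j t))^[n] x) = Real.exp t ^ n * lightConeCoord j x := by
  have h : Semiconj (lightConeCoord j) (lorentzAct (boost j t)) (Real.exp t * ·) :=
    lightConeCoord_boost j t
  rw [(h.iterate_right n).eq, mul_left_iterate]

theorem minkowskiInner_eq_neg_add_sum (x y : Minkowski d) :
    minkowskiInner x y = -(x 0 * y 0) + ∑ i : Fin d, x i.succ * y i.succ := by
  simp [minkowskiInner, minkowskiMatrix, dotProduct, mulVec_diagonal, Fin.sum_univ_succ]

theorem lightConeCoord_pos (j : Fin d) (x : Hyperboloid d) : 0 < lightConeCoord j x := by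
  obtain ⟨x, hx, hx0⟩ := x
  rw [minkowskiInner_eq_neg_add_sum] at hx
  have hj : x j.succ * x j.succ ≤ ∑ i : Fin d, x i.succ * x i.succ :=
    Finset.single_le_sum (f := fun i ↦ x i.succ * x i.succ) (fun i _ ↦ mul_self_nonneg _)
      (Finset.mem_univ j)
  have habs : |x j.succ| < x 0 := abs_lt_of_sq_lt_sq (by nlinarith) hx0.le
  rw [lightConeCoord]
  linarith [neg_abs_le (x j.succ)]

theorem not_mapClusterPt_iterate_boost (j : Fin d) {t : ℝ} (ht : 0 < t) (x : Hyperboloid d)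
    (y : Minkowski d) : ¬ MapClusterPt y atTop fun n ↦ (lorentzAct (boost j t))^[n] x := by
  intro hy
  have hescape :
      Tendsto (fun n ↦ lightConeCoord j ((lorentzAct (boost j t))^[n] x)) atTop atTop := by
    simp only [lightConeCoord_iterate_boost]
    exact (tendsto_pow_atTop_atTop_of_one_lt (Real.one_lt_exp_iff.2 ht)).atTop_mul_const
      (lightConeCoord_pos j x)
  have hcluster := hy.continuousAt_comp (continuous_lightConeCoord j).continuousAt
  exact hcluster.clusterPt.neBot.ne (disjoint_iff.1 ((disjoint_nhds_atTop _).mono_right hescape))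

end Boost

theorem mainTheorem2_general {d : ℕ} (hd : 0 < d) {X : Type*} [MeasurableSpace X]
    [MulAction (lorentzGroup d) X] [MeasurableConstSMul (lorentzGroup d) X]
    (μ : Measure X) [IsFiniteMeasure μ] [SMulInvariantMeasure (lorentzGroup d) X μ]
    {S : Set X} (hS : NullMeasurableSet S μ) (hpos : μ S ≠ 0) :
    ¬ ∃ D : S → Hyperboloid d, Measurable D ∧ ∀ (L : lorentzGroup d) (x : S) (hx : L • x.1 ∈ S),
      (D ⟨L • x.1, hx⟩ : Minkowski d) = lorentzAct L (D x) := by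
  rintro ⟨D, hD, hDL⟩
  let Λ : lorentzGroup d := boost ⟨0, hd⟩ 1
  have hiter (n : ℕ) (x : S) (hx : (Λ • ·)^[n] x.1 ∈ S) :
      (D ⟨(Λ • ·)^[n] x.1, hx⟩ : Minkowski d) = (lorentzAct Λ)^[n] (D x) := by
    simp only [smul_iterate_apply, lorentzAct_iterate] at hx ⊢
    exact hDL (Λ ^ n) x hx
  have hrec := ae_mapClusterPt_iterate_of_conservative (measurePreserving_smul Λ μ).conservative hS
    (measurable_subtype_coe.comp hD) hiter
  obtain ⟨x, hx, hxrec⟩ := ((frequently_ae_mem_iff.2 hpos).and_eventually hrec).exists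
  exact not_mapClusterPt_iterate_boost _ one_pos _ _ (hxrec hx)

theorem mainTheorem2 (d : ℕ) (hd : 1 < d + 1) (ρ : ℝ) (hρ : 0 < ρ)
    (μ : MeasureTheory.Measure (Sprinkling d)) (hμ : IsPoissonProcess ρ μ)
    (S : Set (Sprinkling d)) (hS : MeasurableSet S) (hpos : 0 < μ S) :
    ¬ ∃ D : S → Hyperboloid d, Measurable D ∧
      ∀ (L : lorentzGroup d) (ω : S) (hω : Sprinkling.act L ω ∈ S),
        (D ⟨Sprinkling.act L ω, hω⟩ : Minkowski d) = lorentzAct L (D ω) := by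
  have := hμ.isProbabilityMeasure
  have := hμ.smulInvariantMeasure
  exact mainTheorem2_general (by omega) μ hS.nullMeasurableSet hpos.ne'
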